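/- A \emph{generalized task system} $(\mathcal S,\mathcal T,d)$ consists of a set $\mathcal S$ of states, a function $d:\mathcal S\times\mathcal S\to[0,\infty)$, and a set $\mathcal T$ of tasks, each task being a map $t:\mathcal S\to[0,\infty]$ with $t(s)\neq\infty$ for at least one $s\in\mathcal S$. It is a \emph{lazy task system} if $d(s,s')>0$ whenever $s\neq s'$ and $d(s,s')\le d(s,s'')+d(s'',s')$ for all $s,s',s''\in\mathcal S$ (neither symmetry nor $d(s,s)=0$ is required). An input $\sigma=(s_0,t_1,\dots,t_n)$ consists of an initial state $s_0\in\mathcal S$ and finitely many tasks $t_i\in\mathcal T$. A valid output is a sequence $(s_1,\dots,s_n)$ of states with $t_i(s_i)\neq\infty$ for all $i$; its cost is $\sum_{i=1}^n\big(d(s_{i-1},s_i)+t_i(s_i)\big)$, and $\mathrm{OPT}(\sigma)$ is the minimum cost of a valid output. A deterministic online algorithm $D$ produces a valid output on every input, where $s_i$ depends only on $(s_0,t_1,\dots,t_i)$; $D(\sigma)$ denotes its cost. A randomized online algorithm $R$ is a probability distribution over deterministic online algorithms. It is $c$-competitive if there is a constant $\alpha$ such that $\mathbb E[R(\sigma)]\le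 c\cdot\mathrm{OPT}(\sigma)+\alpha$ for all inputs $\sigma$, and its competitive ratio is the infimum of all $c$ for which it is $c$-competitive ($\infty$ if there are none). \textbf{Theorem.} Let $(\mathcal S,\mathcal T,d)$ be a lazy task system such that $\mathcal S$ and $\mathcal T$ are both finite. Then $(\mathcal S,\mathcal T,d)$ is compact, that is: for every constant $c>1$ such that every randomized online algorithm has competitive ratio at least $c$, and for all $\varepsilon>0$ and $\alpha\ge 0$, there is a probability distribution $p$ on inputs with finite support such that every deterministic online algorithm $D$ satisfies $$\mathbb E_{\sigma\sim p}[D(\sigma)]\;\ge\;(c-\varepsilon)\,\mathbb E_{\sigma\sim p}[\mathrm{OPT}(\sigma)]+\alpha .$$ -/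

import Mathlib

open MeasureTheory
open scoped NNReal ENNReal

/-- A generalized task system with state set `S`: a set of allowable tasks, each of which is a map
`S → [0, ∞]` that is finite on at least one state, together with an arbitrary function
`d : S × S → [0, ∞)`. -/
structure GTS (S : Type*) where
  tasks : Set (S → ℝ≥0∞)
  d : S → S → ℝ≥0
  exists_available : ∀ t ∈ tasks, ∃ s, t s ≠ ∞

/-- A lazy task system: distinct states have positive distance, and the (not necessarily symmetric)
triangle inequality holds. It is not required that `d s s = 0`. -/
structure GTS.IsLTS {S : Type*} (P : GTS S) : Prop where
  d_pos : ∀ s s' : S, s ≠ s' → 0 < P.d s s'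
  d_triangle : ∀ s s' s'' : S, P.d s s' ≤ P.d s s'' + P.d s'' s'

namespace GTS

variable {S : Type*}

/-- An input `(s₀, t₁, …, tₙ)`: an initial state and a finite sequence of allowable tasks. -/
structure Input (P : GTS S) where
  init : S
  tasks : List P.tasks

/-- An output `(s₁, …, sₙ)` is valid for `(t₁, …, tₙ)` if `tᵢ(sᵢ) ≠ ∞` for all `i`
(in particular it has the same length). -/
def IsValidOutput (P : GTS S) (ts : List P.tasks) (ys : List S) : Prop :=
  List.Forall₂ (fun (t : P.tasks) (s : S) => t.1 s ≠ ∞) ts ys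

/-- The total cost `∑ᵢ (d(sᵢ₋₁, sᵢ) + tᵢ(sᵢ))` of serving `(t₁, …, tₙ)` by moving from the state
`s₀` to `s₁, …, sₙ` in this order; only used for valid outputs. -/
noncomputable def totalCost (P : GTS S) : S → List P.tasks → List S → ℝ
  | s, t :: ts, s' :: ys => (P.d s s' + (t.1 s').toReal) + P.totalCost s' ts ys
  | _, _, _ => 0

/-- The optimal offline cost: the least cost of a valid output. -/
noncomputable def opt (P : GTS S) (σ : P.Input) : ℝ :=
  ⨅ y : {y : List S // P.IsValidOutput σ.tasks y}, P.totalCost σ.init σ.tasks y.1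

/-- A deterministic online algorithm (without advice): `next s₀ [t₁, …, tᵢ₋₁] tᵢ` is the state in
which the `i`-th task is served; it must be available for that task. -/
structure DetAlg (P : GTS S) where
  next : S → List P.tasks → P.tasks → S
  valid : ∀ (s₀ : S) (past : List P.tasks) (t : P.tasks), t.1 (next s₀ past t) ≠ ∞

/-- The states chosen by the algorithm while serving the given tasks, when the tasks in `past` have
already been served. -/
def DetAlg.serve {P : GTS S} (D : P.DetAlg) (s₀ : S) (past : List P.tasks) :
    List P.tasks → List S
  | [] => []
  | t :: ts => D.next s₀ past t :: D.serve s₀ (past ++ [t]) ts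

/-- The output `(s₁, …, sₙ)` of a deterministic algorithm. -/
def DetAlg.output {P : GTS S} (D : P.DetAlg) (σ : P.Input) : List S :=
  D.serve σ.init [] σ.tasks

/-- The cost `D(σ)`. -/
noncomputable def DetAlg.cost {P : GTS S} (D : P.DetAlg) (σ : P.Input) : ℝ :=
  P.totalCost σ.init σ.tasks (D.output σ)

/-- The σ-algebra on deterministic algorithms generated by the individual answers, where the state
set carries the discrete σ-algebra. -/
instance (P : GTS S) : MeasurableSpace P.DetAlg :=
  ⨆ (s₀ : S) (past : List P.tasks) (t : P.tasks),
    MeasurableSpace.comap (fun D : P.DetAlg => D.next s₀ past t) ⊤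

/-- A randomized online algorithm: a probability distribution over deterministic ones. -/
abbrev RandAlg (P : GTS S) : Type _ := ProbabilityMeasure P.DetAlg

/-- `R` is `c`-competitive: for some constant `α`, `E[R(σ)] ≤ c · OPT(σ) + α` for all inputs `σ`.
The additive constant does not depend on the initial state. -/
def IsCompetitive (P : GTS S) (R : P.RandAlg) (c : ℝ) : Prop :=
  ∃ α : ℝ, ∀ σ : P.Input,
    Integrable (fun D : P.DetAlg => D.cost σ) (R : Measure P.DetAlg) ∧
      ∫ D : P.DetAlg, D.cost σ ∂(R : Measure P.DetAlg) ≤ c * P.opt σ + α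

/-- The (expected) competitive ratio of `R`: the infimum of all `c` such that `R` is
`c`-competitive, which is `∞` if there is no such `c`. -/
noncomputable def competitiveRatio (P : GTS S) (R : P.RandAlg) : EReal :=
  ⨅ (c : ℝ) (_ : P.IsCompetitive R c), (c : EReal)

/-- The expectation of `f` under a discrete distribution; used for finite support only. -/
noncomputable def expect {P : GTS S} (p : PMF P.Input) (f : P.Input → ℝ) : ℝ :=
  ∑' σ : P.Input, (p σ).toReal * f σ

/-- Compactness: whenever `c > 1` is a lower bound on the competitive ratio of all randomized
algorithms, then for all `ε > 0` and `α ≥ 0` there is an input distribution `p` with finite support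
such that `E_p[D(σ)] ≥ (c - ε) · E_p[OPT(σ)] + α` for every deterministic algorithm `D`. -/
def Compact (P : GTS S) : Prop :=
  ∀ c : ℝ, 1 < c → (∀ R : P.RandAlg, (c : EReal) ≤ P.competitiveRatio R) →
    ∀ ε : ℝ, 0 < ε → ∀ α : ℝ, 0 ≤ α →
      ∃ p : PMF P.Input, p.support.Finite ∧
        ∀ D : P.DetAlg,
          expect p (fun σ => D.cost σ) ≥ (c - ε) * expect p (fun σ => P.opt σ) + α

end GTS

/-! The proof is a minimax argument by contradiction. A deterministic algorithm is a point of a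
product of finite sets, which is compact by Tychonoff, and its cost on a fixed input is continuous.
If no distribution `p` works, then every finite mixture of inputs has an algorithm with expected
cost below `(c - ε) * OPT + α`. Minimax, via Hahn–Banach and Riesz–Markov, turns this into one
probability measure on algorithms that meets the bound on every input: a `(c - ε)`-competitive
randomized algorithm. -/

open scoped CompactlySupported in
/-- A Ky Fan type minimax principle: if no finite convex combination of the continuous functions
`f i` on a compact Hausdorff space is positive everywhere, then some probability measure gives each
`f i` a nonpositive integral. -/
theorem exists_isProbabilityMeasure_integral_nonpos {K ι : Type*} [TopologicalSpace K]
    [CompactSpace K] [T2Space K] [Nonempty K] [MeasurableSpace K] [BorelSpace K] (f : ι → C(K, ℝ))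
    (h : ∀ (s : Finset ι) (w : ι → ℝ), (∀ i ∈ s, 0 ≤ w i) → ∑ i ∈ s, w i = 1 →
      ∃ k, ∑ i ∈ s, w i * f i k ≤ 0) :
    ∃ μ : Measure K, IsProbabilityMeasure μ ∧ ∀ i, ∫ k, f i k ∂μ ≤ 0 := by
  rcases isEmpty_or_nonempty ι with hι | ⟨⟨i₀⟩⟩
  · exact ⟨Measure.dirac (Classical.arbitrary K), inferInstance, fun i => isEmptyElim i⟩
  set B : Set C(K, ℝ) := {g | ∀ k, 0 < g k} with hB
  have hBo : IsOpen B := by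
    have := ContinuousMap.isOpen_setOfPred_mapsTo (X := K) (Y := ℝ) isCompact_univ
      (isOpen_Ioi (a := (0 : ℝ)))
    convert this using 1
    ext g
    simp [hB, Set.MapsTo]
  have hBc : Convex ℝ B := by
    intro g hg g' hg' a b ha hb hab k
    have h1 := hg k
    have h2 := hg' k
    simp only [ContinuousMap.add_apply, ContinuousMap.smul_apply, smul_eq_mul]
    rcases ha.eq_or_lt with rfl | ha
    · have : b = 1 := by linarith
      subst this
      simpa using h2
    · have := mul_pos ha h1
      have := mul_nonneg hb h2.le
      linarith
  have hdisj : Disjoint B (convexHull ℝ (Set.range f)) := by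
    rw [Set.disjoint_left]
    intro g hg hg'
    rw [convexHull_range_eq_exists_affineCombination] at hg'
    obtain ⟨s, w, hw0, hw1, rfl⟩ := hg'
    obtain ⟨k, hk⟩ := h s w hw0 hw1
    have := hg k
    rw [Finset.affineCombination_eq_linear_combination _ _ _ hw1] at this
    simp only [ContinuousMap.sum_apply, ContinuousMap.smul_apply, smul_eq_mul] at this
    exact absurd this (not_lt.2 hk)
  obtain ⟨L, u, hLB, hLA⟩ :=
    geometric_hahn_banach_open hBc hBo (convex_convexHull ℝ (Set.range f)) hdisj
  have hLf : ∀ i, u ≤ L (f i) := fun i => hLA _ (subset_convexHull ℝ _ ⟨i, rfl⟩)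
  have hone : (1 : C(K, ℝ)) ∈ B := fun k => by simp
  have hsmul : ∀ g ∈ B, ∀ t : ℝ, 0 < t → t * L g < u := by
    intro g hg t ht
    have : t • g ∈ B := fun k => by simpa using mul_pos ht (hg k)
    simpa using hLB _ this
  -- `B` is closed under positive scaling, so a bound on `L` over `B` cannot be negative.
  have hu : 0 ≤ u := by
    by_contra! hu
    have h1 := hsmul 1 hone 1 one_pos
    have h2 := hsmul 1 hone (u / (2 * L 1)) (div_pos_of_neg_of_neg hu (by linarith))
    have h3 : L 1 ≠ 0 := by linarith
    have : u / (2 * L 1) * L 1 = u / 2 := by field_simp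
    linarith
  have hBnonpos : ∀ g ∈ B, L g ≤ 0 := by
    intro g hg
    by_contra! hpos
    have := hsmul g hg ((u + 1) / L g) (by positivity)
    rw [div_mul_cancel₀ _ hpos.ne'] at this
    linarith
  -- Strictness excludes the zero measure: a large constant plus `f i₀` lies in `B`, while `L (f
  -- i₀)` is already at least `u`.
  have hL1 : L 1 < 0 := by
    have hM : (‖f i₀‖ + 1) • (1 : C(K, ℝ)) + f i₀ ∈ B := by
      intro k
      have := (abs_le.1 ((f i₀).norm_coe_le_norm k)).1
      simp
      linarith
    have h1 := hLB _ hM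
    rw [map_add, map_smul, smul_eq_mul] at h1
    have h2 := hLf i₀
    have h3 := norm_nonneg (f i₀)
    nlinarith
  have hnonpos : ∀ g : C(K, ℝ), (∀ k, 0 ≤ g k) → L g ≤ 0 := by
    intro g hg
    refine le_of_forall_pos_le_add fun ε hε => ?_
    have hmem : (ε / (-L 1)) • (1 : C(K, ℝ)) + g ∈ B := by
      intro k
      have := hg k
      have : 0 < ε / (-L 1) := div_pos hε (by linarith)
      simp only [ContinuousMap.add_apply, ContinuousMap.smul_apply, ContinuousMap.one_apply,
        smul_eq_mul, mul_one]
      linarith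
    have h1 := hBnonpos _ hmem
    rw [map_add, map_smul, smul_eq_mul] at h1
    have : ε / (-L 1) * L 1 = -ε := by
      have := hL1.ne
      field_simp
    linarith
  let Λ : C_c(K, ℝ) →ₚ[ℝ] ℝ := PositiveLinearMap.mk₀
    { toFun := fun g => -L g.toContinuousMap
      map_add' := fun g g' => by
        have : (g + g').toContinuousMap = g.toContinuousMap + g'.toContinuousMap := rfl
        rw [this, map_add]
        ring
      map_smul' := fun a g => by
        have : (a • g).toContinuousMap = a • g.toContinuousMap := rfl
        rw [this, map_smul]
        simp }
    (fun g hg => by simpa using hnonpos g.toContinuousMap hg)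
  have hΛ : ∀ g : C(K, ℝ), ∫ k, g k ∂(RealRMK.rieszMeasure Λ) = -L g := fun g =>
    RealRMK.integral_rieszMeasure Λ (CompactlySupportedContinuousMap.continuousMapEquiv g)
  set μ := RealRMK.rieszMeasure Λ
  have hμ : μ.real Set.univ = -L 1 := by
    simpa using hΛ 1
  have hμ0 : μ ≠ 0 := by
    rintro h0
    rw [h0] at hμ
    simp at hμ
    linarith
  have hμfin : IsFiniteMeasure μ := by
    -- `Measure.real` sends infinite mass to `0`, but here it equals `-L 1 > 0`.
    refine ⟨lt_top_iff_ne_top.2 fun htop => ?_⟩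
    rw [Measure.real, htop] at hμ
    simp at hμ
    linarith
  have : NeZero μ := ⟨hμ0⟩
  refine ⟨(μ Set.univ)⁻¹ • μ, inferInstance, fun i => ?_⟩
  rw [integral_smul_measure, hΛ, smul_eq_mul]
  exact mul_nonpos_of_nonneg_of_nonpos ENNReal.toReal_nonneg (by linarith [hLf i])

/-- The probability distribution with the given finitely many weights. -/
noncomputable def PMF.ofWeights {ι : Type*} (s : Finset ι) (w : ι → ℝ) (hw0 : ∀ i ∈ s, 0 ≤ w i)
    (hw1 : ∑ i ∈ s, w i = 1) : PMF ι :=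
  PMF.ofFinset ((s : Set ι).indicator fun i => ENNReal.ofReal (w i)) s
    (by
      rw [Finset.sum_congr rfl fun i hi => Set.indicator_of_mem (Finset.mem_coe.2 hi) _,
        ← ENNReal.ofReal_sum_of_nonneg hw0, hw1, ENNReal.ofReal_one])
    (fun i hi => Set.indicator_of_notMem (by simpa using hi) _)

theorem PMF.support_ofWeights_subset {ι : Type*} (s : Finset ι) (w : ι → ℝ)
    (hw0 : ∀ i ∈ s, 0 ≤ w i) (hw1 : ∑ i ∈ s, w i = 1) :
    (PMF.ofWeights s w hw0 hw1).support ⊆ s := by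
  intro i hi
  by_contra his
  exact hi (by simpa [PMF.ofWeights] using fun h => absurd (Finset.mem_coe.2 h) his)

namespace GTS

variable {S : Type*} {P : GTS S}

theorem expect_ofWeights (s : Finset P.Input) (w : P.Input → ℝ) (hw0 : ∀ i ∈ s, 0 ≤ w i)
    (hw1 : ∑ i ∈ s, w i = 1) (f : P.Input → ℝ) :
    expect (PMF.ofWeights s w hw0 hw1) f = ∑ i ∈ s, w i * f i := by
  rw [expect, tsum_eq_sum (s := s)]
  · refine Finset.sum_congr rfl fun i hi => ?_
    simp [PMF.ofWeights, hi, ENNReal.toReal_ofReal (hw0 i hi)]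
  · intro i hi
    simp [PMF.ofWeights, hi]

/-- The space of deterministic algorithms, as a product of finite sets of available states. -/
abbrev AnswerSpace (P : GTS S) : Type _ :=
  ∀ i : S × List P.tasks × P.tasks, {s : S // i.2.2.1 s ≠ ∞}

/-- Deterministic algorithms are the families of available answers. -/
def answerEquiv (P : GTS S) : P.AnswerSpace ≃ P.DetAlg where
  toFun k := ⟨fun s₀ past t => (k (s₀, past, t)).1, fun s₀ past t => (k (s₀, past, t)).2⟩
  invFun D i := ⟨D.next i.1 i.2.1 i.2.2, D.valid i.1 i.2.1 i.2.2⟩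
  left_inv _ := rfl
  right_inv _ := rfl

/-- The equivalence `answerEquiv` is an isomorphism of measurable spaces, where the states carry the
discrete σ-algebra. -/
def answerMeasurableEquiv (P : GTS S) [MeasurableSpace S] [DiscreteMeasurableSpace S] :
    P.AnswerSpace ≃ᵐ P.DetAlg where
  toEquiv := P.answerEquiv
  measurable_toFun := by
    refine measurable_iff_comap_le.2 ?_
    simp only [instMeasurableSpaceDetAlg, MeasurableSpace.comap_iSup, MeasurableSpace.comap_comp,
      iSup_le_iff]
    intro s₀ past t
    rintro _ ⟨A, -, rfl⟩
    exact (measurable_subtype_coe.comp (measurable_pi_apply (s₀, past, t)))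
      (MeasurableSet.of_discrete (s := A))
  measurable_invFun := by
    refine measurable_pi_lambda _ fun i => Measurable.subtype_mk ?_
    intro A _
    have hle : MeasurableSpace.comap (fun D : P.DetAlg => D.next i.1 i.2.1 i.2.2) ⊤ ≤
        instMeasurableSpaceDetAlg P :=
      le_iSup_of_le i.1 <| le_iSup_of_le i.2.1 <| le_iSup
        (fun t => MeasurableSpace.comap (fun D : P.DetAlg => D.next i.1 i.2.1 t) ⊤) i.2.2
    exact hle _ ⟨A, trivial, rfl⟩

/-- Serving a fixed input consults only finitely many coordinates, each with discrete values. -/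
theorem continuous_totalCost_serve [TopologicalSpace S] [DiscreteTopology S] (s₀ : S)
    (ts past : List P.tasks) (s : S) :
    Continuous fun k : P.AnswerSpace =>
      P.totalCost s ts ((P.answerEquiv k).serve s₀ past ts) := by
  induction ts generalizing past s with
  | nil => simpa [DetAlg.serve, totalCost] using continuous_const
  | cons t ts ih =>
    have hk : Continuous fun k : P.AnswerSpace => ((k (s₀, past, t)).1, k) := by fun_prop
    have hG : Continuous fun x : S × P.AnswerSpace => ((P.d s x.1 : ℝ) + (t.1 x.1).toReal) +
        P.totalCost x.1 ts ((P.answerEquiv x.2).serve s₀ (past ++ [t]) ts) :=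
      continuous_prod_of_discrete_left.2 fun a =>
        (continuous_const (y := (P.d s a : ℝ) + (t.1 a).toReal)).add (ih (past ++ [t]) a)
    exact hG.comp hk

end GTS

open GTS in
theorem mainTheorem8 {S : Type*} [Finite S] (P : GTS S) (hT : P.tasks.Finite) (hP : P.IsLTS) :
    P.Compact := by
  intro c _ hc ε hε α _
  by_contra! hcon
  let _ : TopologicalSpace S := ⊥
  have : DiscreteTopology S := ⟨rfl⟩
  let _ : MeasurableSpace S := ⊤
  have : BorelSpace S := ⟨borel_eq_top_of_discrete.symm⟩
  -- This makes the index set of `AnswerSpace` countable, so that its product σ-algebra is Borel.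
  have : Finite P.tasks := hT
  have : ∀ i : S × List P.tasks × P.tasks, Nonempty {s : S // i.2.2.1 s ≠ ∞} := fun i =>
    let ⟨s, hs⟩ := P.exists_available i.2.2.1 i.2.2.2
    ⟨⟨s, hs⟩⟩
  let e := P.answerMeasurableEquiv
  let f : P.Input → C(P.AnswerSpace, ℝ) := fun σ =>
    ⟨fun k => (e k).cost σ, continuous_totalCost_serve _ _ _ _⟩
  obtain ⟨μ, hμ, hμf⟩ := exists_isProbabilityMeasure_integral_nonpos
    (fun σ => f σ - ContinuousMap.const P.AnswerSpace ((c - ε) * P.opt σ + α)) (by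
      intro s w hw0 hw1
      obtain ⟨D, hD⟩ := hcon (PMF.ofWeights s w hw0 hw1)
        (s.finite_toSet.subset (PMF.support_ofWeights_subset s w hw0 hw1))
      refine ⟨e.symm D, ?_⟩
      rw [expect_ofWeights, expect_ofWeights] at hD
      have : ∑ σ ∈ s, w σ * ((f σ - ContinuousMap.const P.AnswerSpace ((c - ε) * P.opt σ + α)) (e.symm D)) =
          ∑ σ ∈ s, w σ * D.cost σ - ((c - ε) * ∑ σ ∈ s, w σ * P.opt σ + α) := by
        have hf : ∀ σ, f σ (e.symm D) = D.cost σ := fun σ => by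
          change (e (e.symm D)).cost σ = _
          rw [e.apply_symm_apply]
        have hα : α = ∑ σ ∈ s, w σ * α := by rw [← Finset.sum_mul, hw1, one_mul]
        nth_rewrite 2 [hα]
        rw [Finset.mul_sum, ← Finset.sum_add_distrib, ← Finset.sum_sub_distrib]
        refine Finset.sum_congr rfl fun σ _ => ?_
        rw [ContinuousMap.sub_apply, ContinuousMap.const_apply, hf]
        ring
      linarith)
  have hint : ∀ σ, Integrable (f σ) μ := fun σ =>
    (f σ).continuous.integrable_of_hasCompactSupport (HasCompactSupport.of_compactSpace _)
  -- The minimax measure, transported to algorithms; `α` itself serves as its additive constant.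
  let R : P.RandAlg := ⟨μ.map e, Measure.isProbabilityMeasure_map e.measurable.aemeasurable⟩
  have hR : P.IsCompetitive R (c - ε) := by
    refine ⟨α, fun σ => ⟨(integrable_map_equiv e _).2 (hint σ), ?_⟩⟩
    have h1 := hμf σ
    simp only [ContinuousMap.sub_apply, ContinuousMap.const_apply] at h1
    rw [integral_sub (hint σ) (integrable_const _), integral_const] at h1
    simp only [probReal_univ, one_smul] at h1
    change ∫ D : P.DetAlg, D.cost σ ∂(μ.map e) ≤ _
    rw [integral_map_equiv]
    exact sub_nonpos.1 h1
  have hle : (c : EReal) ≤ ((c - ε : ℝ) : EReal) :=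
    (hc R).trans (iInf₂_le_of_le (c - ε) hR le_rfl)
  have := EReal.coe_le_coe_iff.1 hle
  linarith
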